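/- Theorem (Grätzer–Schmidt 2002). Call a congruence relation $\Theta$ of a lattice $L$ isoform if any two congruence classes of $\Theta$ are isomorphic as lattices (each class being a sublattice of $L$), and call $L$ isoform if all congruences of $L$ are isoform. For every finite distributive lattice $D$ there exists a finite isoform lattice $L$ whose congruence lattice $\operatorname{Con} L$ (all congruence relations of $L$, ordered by inclusion) is isomorphic to $D$. (Lattices are nonempty.) -/

import Mathlib

universe u

namespace LatticeCon

/-- Congruences of a lattice are ordered by inclusion of relations. -/
instance instPartialOrder (α : Type u) [Lattice α] : PartialOrder (LatticeCon α) where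
  le c d := ∀ ⦃x y : α⦄, c.r x y → d.r x y
  le_refl _ _ _ h := h
  le_trans _ _ _ h₁ h₂ _ _ h := h₂ (h₁ h)
  le_antisymm c d h₁ h₂ := by
    obtain ⟨⟨r, _⟩, _, _⟩ := c
    obtain ⟨⟨s, _⟩, _, _⟩ := d
    have h : r = s := by
      funext x y
      exact propext ⟨fun h => h₁ h, fun h => h₂ h⟩
    subst h
    rfl

/-- The infimum of a set of congruences is their intersection. -/
instance instInfSet (α : Type u) [Lattice α] : InfSet (LatticeCon α) where
  sInf S :=
    { r := fun x y => ∀ c ∈ S, c.r x y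
      iseqv :=
        ⟨fun x c _ => c.iseqv.refl x, fun h c hc => c.iseqv.symm (h c hc),
          fun h₁ h₂ c hc => c.iseqv.trans (h₁ c hc) (h₂ c hc)⟩
      inf := fun h₁ h₂ c hc => c.inf (h₁ c hc) (h₂ c hc)
      sup := fun h₁ h₂ c hc => c.sup (h₁ c hc) (h₂ c hc) }

/-- The congruence lattice `Con L` of a lattice `L`: all congruences of `L`, ordered by
inclusion. -/
instance instCompleteLattice (α : Type u) [Lattice α] : CompleteLattice (LatticeCon α) :=
  completeLatticeOfInf (LatticeCon α) fun _ =>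
    ⟨fun c hc _ _ h => h c hc, fun _ hd _ _ h c hc => hd hc h⟩

/-- The congruence class of `a` modulo `c`, a sublattice of the ambient lattice. -/
def congrClass {α : Type u} [Lattice α] (c : LatticeCon α) (a : α) : Sublattice α where
  carrier := {x | c.r x a}
  supClosed' x hx y hy := by
    have h := c.sup hx hy
    rwa [sup_idem] at h
  infClosed' x hx y hy := by
    have h := c.inf hx hy
    rwa [inf_idem] at h

/-- A congruence is isoform if any two of its classes are isomorphic as lattices
(an order isomorphism of lattices is the same as a lattice isomorphism). -/
def IsIsoform {α : Type u} [Lattice α] (c : LatticeCon α) : Prop :=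
  ∀ a b : α, Nonempty (c.congrClass a ≃o c.congrClass b)

end LatticeCon

/-- A lattice is isoform if all of its congruences are isoform. -/
def IsIsoformLattice (L : Type u) [Lattice L] : Prop :=
  ∀ c : LatticeCon L, c.IsIsoform

/-! By Birkhoff, `D` is the lattice of lower sets of the poset `P` of its join-irreducibles, so it
suffices that the congruences of an isoform lattice correspond to lower sets of `P`. In a power of
the simple five-element diamond, congruences correspond to arbitrary sets of collapsed coordinates.
Pruning removes the comparabilities between elements equal to `v` at `q` but different somewhere
above `q`. Collapsing a coordinate then forces the collapse of all lower ones (`rel_single_of_le`).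

Joins and meets at `q` depend only on coordinates at or above `q` (`prunedSup_congr`), so agreement
off a lower set is a congruence. Its classes are isomorphic by exchanging the fixed coordinates
(`graft_le_graft`). Simplicity of the diamond shows that there are no other congruences
(`rel_single_of_ne`, `agreeOff_collapsed`). -/

/-- The five-element modular nondistributive lattice, with a distinguished atom `v`. -/
inductive Diamond : Type
  | bot | v | a | b | top
  deriving DecidableEq

/-! ### The simple diamond -/

namespace Diamond

instance : Fintype Diamond := ⟨{bot, v, a, b, top}, by intro x; cases x <;> decide⟩

instance : LE Diamond := ⟨fun x y => x = y ∨ x = bot ∨ y = top⟩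

instance : DecidableLE Diamond := fun x y =>
  inferInstanceAs (Decidable (x = y ∨ x = bot ∨ y = top))

instance : Lattice Diamond where
  le_refl := by decide
  le_trans := by decide
  le_antisymm := by decide
  sup x y := if x = y then x else if x = bot then y else if y = bot then x else top
  inf x y := if x = y then x else if x = top then y else if y = top then x else bot
  le_sup_left := by decide
  le_sup_right := by decide
  sup_le := by decide
  inf_le_left := by decide
  inf_le_right := by decide
  le_inf := by decide

instance : BoundedOrder Diamond where
  top := top
  le_top := by decide
  bot := bot
  bot_le := by decide

/-- The diamond is simple. -/
theorem bot_rel_top {r : Diamond → Diamond → Prop} (hr : Equivalence r)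
    (hinf : ∀ {x y} z, r x y → r (x ⊓ z) (y ⊓ z)) (hsup : ∀ {x y} z, r x y → r (x ⊔ z) (y ⊔ z))
    {s t : Diamond} (hst : s ≠ t) (h : r s t) : r ⊥ ⊤ := by
  -- Some unary lattice polynomial sends any two distinct elements to `⊥` and `v`, in one order or
  -- the other.
  have key : ∀ s t : Diamond, s ≠ t → ∃ d e f g,
      ((((s ⊔ d) ⊓ e) ⊔ f) ⊓ g = ⊥ ∧ (((t ⊔ d) ⊓ e) ⊔ f) ⊓ g = v) ∨
      ((((s ⊔ d) ⊓ e) ⊔ f) ⊓ g = v ∧ (((t ⊔ d) ⊓ e) ⊔ f) ⊓ g = ⊥) := by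
    decide +kernel
  have hv : r ⊥ v := by
    obtain ⟨d, e, f, g, ⟨h₁, h₂⟩ | ⟨h₁, h₂⟩⟩ := key s t hst
    · simpa only [h₁, h₂] using hinf g (hsup f (hinf e (hsup d h)))
    · simpa only [h₁, h₂] using hr.symm (hinf g (hsup f (hinf e (hsup d h))))
  have hb : r ⊥ b := hinf b (hsup a hv)
  exact hr.trans hb (hsup b hv)

/-- Distinct elements can be moved away from `v` while staying distinct. -/
theorem exists_separating : ∀ s t : Diamond, s ≠ t → ∃ d : Diamond,
    ((s ⊔ d ≠ t ⊔ d ∧ s ⊔ d ≠ v ∧ t ⊔ d ≠ v) ∨ (s ⊓ d ≠ t ⊓ d ∧ s ⊓ d ≠ v ∧ t ⊓ d ≠ v)) := by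
  decide +kernel

end Diamond

/-! ### Joins in a pruned power -/

section Pruning

variable {P : Type*} [PartialOrder P] {S : Type*}

/-- The pruned product order: `x ≤ y` pointwise, and if both take the value `v` at `q`
then they agree strictly above `q`. -/
def PrunedLE [LE S] (v : S) (x y : P → S) : Prop :=
  (∀ p, x p ≤ y p) ∧ ∀ q, x q = v → y q = v → ∀ p, q < p → x p = y p

theorem PrunedLE.refl [Preorder S] (v : S) (x : P → S) : PrunedLE v x x :=
  ⟨fun _ => le_rfl, fun _ _ _ _ _ => rfl⟩

theorem PrunedLE.antisymm [PartialOrder S] {v : S} {x y : P → S} (h : PrunedLE v x y)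
    (h' : PrunedLE v y x) : x = y :=
  funext fun p => le_antisymm (h.1 p) (h'.1 p)

theorem PrunedLE.trans [PartialOrder S] {v : S} {x y z : P → S} (h : PrunedLE v x y)
    (h' : PrunedLE v y z) : PrunedLE v x z := by
  refine ⟨fun p => (h.1 p).trans (h'.1 p), fun q hx hz p hp => ?_⟩
  have hy : y q = v := le_antisymm (hz ▸ h'.1 q) (hx ▸ h.1 q)
  rw [h.2 q hx hy p hp, h'.2 q hy hz p hp]

/-- The pruning condition is symmetric in its two arguments, so every statement about joins dualizes
to meets. -/
theorem prunedLE_toDual [LE S] {v : S} {x y : P → S} :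
    PrunedLE (S := Sᵒᵈ) v x y ↔ PrunedLE v y x :=
  ⟨fun h => ⟨h.1, fun q hy hx p hp => (h.2 q hx hy p hp).symm⟩,
    fun h => ⟨h.1, fun q hx hy p hp => (h.2 q hy hx p hp).symm⟩⟩

variable [Finite P]

open Classical in
/-- The pointwise join, corrected from the top of `P` downwards: a value `v` which would violate
the pruned order is replaced by `⊤`. -/
noncomputable def prunedSup [Max S] [Top S] (v : S) (x y : P → S) : P → S :=
  IsWellFounded.fix (· > ·) fun q w =>
    if x q ⊔ y q = v ∧ ((x q = v ∧ ∃ (p : P) (h : p > q), w p h ≠ x p) ∨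
      (y q = v ∧ ∃ (p : P) (h : p > q), w p h ≠ y p)) then ⊤ else x q ⊔ y q

open Classical in
theorem prunedSup_apply [Max S] [Top S] (v : S) (x y : P → S) (q : P) :
    prunedSup v x y q = if x q ⊔ y q = v ∧
      ((x q = v ∧ ∃ p > q, prunedSup v x y p ≠ x p) ∨
        (y q = v ∧ ∃ p > q, prunedSup v x y p ≠ y p)) then ⊤ else x q ⊔ y q := by
  rw [prunedSup, IsWellFounded.fix_eq]
  simp only [exists_prop]

theorem prunedSup_apply_of_ne [Max S] [Top S] {v : S} {x y : P → S} {q : P}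
    (h : x q ⊔ y q ≠ v) : prunedSup v x y q = x q ⊔ y q := by
  rw [prunedSup_apply, if_neg (fun h' => h h'.1)]

/-- The value of the join at `q` depends only on the values at and above `q`. -/
theorem prunedSup_congr [Max S] [Top S] {v : S} {x y x' y' : P → S} {q : P}
    (hx : ∀ p ≥ q, x p = x' p) (hy : ∀ p ≥ q, y p = y' p) :
    prunedSup v x y q = prunedSup v x' y' q := by
  classical
  induction q using WellFoundedGT.induction with
  | ind q ih =>
    have hw : ∀ p > q, prunedSup v x y p = prunedSup v x' y' p := fun p hp =>
      ih p hp (fun r hr => hx r (hp.le.trans hr)) (fun r hr => hy r (hp.le.trans hr))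
    rw [prunedSup_apply, prunedSup_apply, hx q le_rfl, hy q le_rfl]
    refine if_congr (and_congr_right fun _ => or_congr ?_ ?_) rfl rfl
    · exact and_congr_right fun _ => exists_congr fun p => and_congr_right fun hp => by
        rw [hw p hp, hx p hp.le]
    · exact and_congr_right fun _ => exists_congr fun p => and_congr_right fun hp => by
        rw [hw p hp, hy p hp.le]

variable [Lattice S] [BoundedOrder S] {v : S}

theorem sup_le_prunedSup (x y : P → S) (q : P) : x q ⊔ y q ≤ prunedSup v x y q := by
  rw [prunedSup_apply]
  split_ifs
  · exact le_top
  · exact le_rfl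

theorem prunedSup_comm (x y : P → S) : prunedSup v x y = prunedSup v y x := by
  classical
  funext q
  induction q using WellFoundedGT.induction with
  | ind q ih =>
    rw [prunedSup_apply, prunedSup_apply, sup_comm]
    refine if_congr (and_congr_right fun _ => or_comm.trans (or_congr ?_ ?_)) rfl rfl <;>
    exact and_congr_right fun _ => exists_congr fun p => and_congr_right fun hp => by rw [ih p hp]

theorem prunedLE_sup_left (hv : v ≠ ⊤) (x y : P → S) : PrunedLE v x (prunedSup v x y) := by
  refine ⟨fun p => le_sup_left.trans (sup_le_prunedSup x y p), fun q hx hw p hp => ?_⟩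
  by_contra hne
  rw [prunedSup_apply] at hw
  split_ifs at hw with h
  · exact hv hw.symm
  · exact h ⟨hw, Or.inl ⟨hx, p, hp, Ne.symm hne⟩⟩

theorem prunedLE_sup_right (hv : v ≠ ⊤) (x y : P → S) : PrunedLE v y (prunedSup v x y) :=
  prunedSup_comm (v := v) y x ▸ prunedLE_sup_left hv y x

/-- At a corrected `q`, the bound `u q ≥ v` is `v` or `⊤` because `v` is a coatom. If it is `v`, the
pruning condition and downward induction squeeze the join onto `x` (or `y`) above `q`, so no
correction was due. For the pruning condition of the result, `v` being an atom ensures that a join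
equal to `v` at `q` has `x q = v` or `y q = v`. -/
theorem prunedSup_le (hv : IsAtom v) (hv' : IsCoatom v) {x y u : P → S} (hx : PrunedLE v x u)
    (hy : PrunedLE v y u) : PrunedLE v (prunedSup v x y) u := by
  have hle : ∀ q, prunedSup v x y q ≤ u q := by
    intro q
    induction q using WellFoundedGT.induction with
    | ind q ih =>
      have hsup : x q ⊔ y q ≤ u q := sup_le (hx.1 q) (hy.1 q)
      rw [prunedSup_apply]
      split_ifs with h
      · obtain ⟨hz, h⟩ := h
        rw [hz] at hsup
        refine (hv'.le_iff.1 hsup).elim (fun h => h.ge) fun hu => ?_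
        rcases h with ⟨hxq, p, hp, hne⟩ | ⟨hyq, p, hp, hne⟩
        · refine absurd (le_antisymm ?_ (le_sup_left.trans (sup_le_prunedSup x y p))) hne
          exact (hx.2 q hxq hu p hp) ▸ ih p hp
        · refine absurd (le_antisymm ?_ (le_sup_right.trans (sup_le_prunedSup x y p))) hne
          exact (hy.2 q hyq hu p hp) ▸ ih p hp
      · exact hsup
  refine ⟨hle, fun q hw hu p hp => le_antisymm (hle p) ?_⟩
  have hz : x q ⊔ y q ≤ v := hw ▸ sup_le_prunedSup x y q
  by_cases hxq : x q = v
  · exact hx.2 q hxq hu p hp ▸ le_sup_left.trans (sup_le_prunedSup x y p)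
  by_cases hyq : y q = v
  · exact hy.2 q hyq hu p hp ▸ le_sup_right.trans (sup_le_prunedSup x y p)
  have hx0 : x q = ⊥ := (hv.le_iff.1 (le_sup_left.trans hz)).resolve_right hxq
  have hy0 : y q = ⊥ := (hv.le_iff.1 (le_sup_right.trans hz)).resolve_right hyq
  rw [prunedSup_apply_of_ne (by simpa [hx0, hy0] using hv.1.symm)] at hw
  exact absurd hw (by simpa [hx0, hy0] using hv.1.symm)

end Pruning

theorem Diamond.isAtom_v : IsAtom Diamond.v :=
  ⟨by decide, fun x => by
    revert x
    simp only [lt_iff_le_and_ne]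
    decide⟩

theorem Diamond.isCoatom_v : IsCoatom Diamond.v :=
  ⟨by decide, fun x => by
    revert x
    simp only [lt_iff_le_and_ne]
    decide⟩

/-! ### The lattice `Pruned P` -/

/-- The power `Diamond ^ P` with the pruned product order. -/
def Pruned (P : Type u) : Type u := P → Diamond

namespace Pruned

variable {P : Type u}

open Classical in
/-- The element with value `s` at `p` and `⊥` elsewhere. -/
noncomputable def single (p : P) (s : Diamond) : Pruned P :=
  fun q => if q = p then s else ⊥

theorem single_self (p : P) (s : Diamond) : single p s p = s := if_pos rfl

theorem single_of_ne {p q : P} (h : q ≠ p) (s : Diamond) : single p s q = ⊥ := if_neg h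

open Classical in
/-- The element with value `⊤` on `s` and `⊥` elsewhere. -/
noncomputable def topOn (s : Set P) : Pruned P := fun p => if p ∈ s then ⊤ else ⊥

theorem topOn_of_mem {s : Set P} {p : P} (h : p ∈ s) : topOn s p = ⊤ := if_pos h

variable [PartialOrder P]

open Classical in
/-- Replace the coordinates outside `I` by those of `b`. -/
noncomputable def graft (I : LowerSet P) (b x : Pruned P) : Pruned P :=
  fun p => if p ∈ I then x p else b p

theorem graft_of_mem {I : LowerSet P} {b x : Pruned P} {p : P} (h : p ∈ I) :
    graft I b x p = x p :=
  if_pos h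

theorem graft_of_notMem {I : LowerSet P} {b x : Pruned P} {p : P} (h : p ∉ I) :
    graft I b x p = b p :=
  if_neg h

variable [Finite P]

instance : Finite (Pruned P) := inferInstanceAs (Finite (P → Diamond))

noncomputable instance : Lattice (Pruned P) where
  le := PrunedLE Diamond.v
  le_refl := PrunedLE.refl _
  le_trans _ _ _ := PrunedLE.trans
  le_antisymm _ _ := PrunedLE.antisymm
  sup := prunedSup Diamond.v
  inf := prunedSup (S := Diamondᵒᵈ) Diamond.v
  le_sup_left := prunedLE_sup_left Diamond.isCoatom_v.1
  le_sup_right := prunedLE_sup_right Diamond.isCoatom_v.1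
  sup_le _ _ _ := prunedSup_le Diamond.isAtom_v Diamond.isCoatom_v
  inf_le_left x y := (prunedLE_toDual (S := Diamond)).1
    (prunedLE_sup_left (S := Diamondᵒᵈ) Diamond.isAtom_v.1 x y)
  inf_le_right x y := (prunedLE_toDual (S := Diamond)).1
    (prunedLE_sup_right (S := Diamondᵒᵈ) Diamond.isAtom_v.1 x y)
  le_inf _ _ _ h₁ h₂ := (prunedLE_toDual (S := Diamond)).1 (prunedSup_le (S := Diamondᵒᵈ)
    Diamond.isCoatom_v.dual Diamond.isAtom_v.dual ((prunedLE_toDual (S := Diamond)).2 h₁)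
    ((prunedLE_toDual (S := Diamond)).2 h₂))

theorem sup_apply {x y : Pruned P} {q : P} (h : x q ⊔ y q ≠ Diamond.v) :
    (x ⊔ y) q = x q ⊔ y q :=
  prunedSup_apply_of_ne h

theorem inf_apply {x y : Pruned P} {q : P} (h : x q ⊓ y q ≠ Diamond.v) :
    (x ⊓ y) q = x q ⊓ y q :=
  prunedSup_apply_of_ne (S := Diamondᵒᵈ) h

theorem sup_congr {x y x' y' : Pruned P} {q : P} (hx : ∀ p ≥ q, x p = x' p)
    (hy : ∀ p ≥ q, y p = y' p) : (x ⊔ y) q = (x' ⊔ y') q :=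
  prunedSup_congr hx hy

theorem inf_congr {x y x' y' : Pruned P} {q : P} (hx : ∀ p ≥ q, x p = x' p)
    (hy : ∀ p ≥ q, y p = y' p) : (x ⊓ y) q = (x' ⊓ y') q :=
  prunedSup_congr (S := Diamondᵒᵈ) hx hy

instance : OrderBot (Pruned P) where
  bot _ := ⊥
  bot_le _ := ⟨fun _ => bot_le, fun _ hq => absurd hq Diamond.isAtom_v.1.symm⟩

theorem bot_apply (p : P) : (⊥ : Pruned P) p = ⊥ := rfl

theorem single_bot (p : P) : single p ⊥ = (⊥ : Pruned P) := by
  funext q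
  simp [single, bot_apply]

/-! ### Congruences from lower sets, and their classes -/

/-- The congruence identifying elements which agree outside a lower set of coordinates. -/
def agreeOff (I : LowerSet P) : LatticeCon (Pruned P) where
  r x y := ∀ p ∉ I, x p = y p
  iseqv := ⟨fun _ _ _ => rfl, fun h p hp => (h p hp).symm,
    fun h₁ h₂ p hp => (h₁ p hp).trans (h₂ p hp)⟩
  -- The complement of `I` is an upper set, so it contains every coordinate on which the value at
  -- `q` depends.
  inf h₁ h₂ _ hq := inf_congr (fun p hp => h₁ p fun h => hq (I.lower hp h))
    (fun p hp => h₂ p fun h => hq (I.lower hp h))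
  sup h₁ h₂ _ hq := sup_congr (fun p hp => h₁ p fun h => hq (I.lower hp h))
    (fun p hp => h₂ p fun h => hq (I.lower hp h))

/-- Grafting creates no new pruning violation: a pair `q < p` with `p ∈ I` lies wholly in `I`, and
off `I` the grafts agree. -/
theorem graft_le_graft {I : LowerSet P} {b x y : Pruned P} (h : x ≤ y) :
    graft I b x ≤ graft I b y := by
  refine ⟨fun p => ?_, fun q hxq hyq p hp => ?_⟩
  · by_cases hp : p ∈ I
    · simpa only [graft_of_mem hp] using h.1 p
    · simp only [graft_of_notMem hp, le_refl]
  · by_cases hpI : p ∈ I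
    · have hq := I.lower hp.le hpI
      rw [graft_of_mem hq] at hxq hyq
      simpa only [graft_of_mem hpI] using h.2 q hxq hyq p hp
    · simp only [graft_of_notMem hpI]

theorem graft_graft {I : LowerSet P} {a b x : Pruned P} (hx : (agreeOff I).r x a) :
    graft I a (graft I b x) = x := by
  funext p
  by_cases hp : p ∈ I
  · simp only [graft_of_mem hp]
  · rw [graft_of_notMem hp, hx p hp]

theorem isIsoform_agreeOff (I : LowerSet P) : (agreeOff I).IsIsoform := by
  have hg (b x : Pruned P) : (agreeOff I).r (graft I b x) b := fun p hp => graft_of_notMem hp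
  refine fun a b => ⟨⟨⟨fun x => ⟨graft I b x.1, hg b x.1⟩, fun x => ⟨graft I a x.1, hg a x.1⟩,
    fun x => Subtype.ext (graft_graft x.2), fun x => Subtype.ext (graft_graft x.2)⟩, ?_⟩⟩
  intro x y
  refine ⟨fun h => ?_, fun h => graft_le_graft h⟩
  have h' : graft I a (graft I b x.1) ≤ graft I a (graft I b y.1) := graft_le_graft h
  rwa [graft_graft x.2, graft_graft y.2] at h'

/-! ### Copies of the diamond at single coordinates -/

theorem single_le_single {p : P} {s t : Diamond} (h : s ≤ t) :
    single p s ≤ single p t := by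
  refine ⟨fun q => ?_, fun q _ hq r hr => ?_⟩
  · by_cases hq : q = p
    · simpa only [hq, single_self] using h
    · simp only [single_of_ne hq, le_refl]
  · have hqp : q = p := by
      by_contra hne
      rw [single_of_ne hne] at hq
      exact Diamond.isAtom_v.1 hq.symm
    rw [single_of_ne (hqp ▸ hr).ne', single_of_ne (hqp ▸ hr).ne']

theorem eq_single_of_le {p : P} {x : Pruned P} {t : Diamond} (h : x ≤ single p t) :
    x = single p (x p) := by
  funext q
  by_cases hq : q = p
  · rw [hq, single_self]
  · rw [single_of_ne hq]
    exact le_bot_iff.1 (single_of_ne hq t ▸ h.1 q)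

theorem single_sup_single (p : P) (s t : Diamond) :
    single p s ⊔ single p t = single p (s ⊔ t) := by
  refine le_antisymm (sup_le (single_le_single le_sup_left) (single_le_single le_sup_right)) ?_
  have h : single p s ⊔ single p t ≤ single p ⊤ :=
    sup_le (single_le_single le_top) (single_le_single le_top)
  rw [eq_single_of_le h]
  refine single_le_single (sup_le ?_ ?_)
  · simpa only [single_self] using (le_sup_left : single p s ≤ single p s ⊔ single p t).1 p
  · simpa only [single_self] using (le_sup_right : single p t ≤ single p s ⊔ single p t).1 p

theorem single_inf_single (p : P) (s t : Diamond) :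
    single p s ⊓ single p t = single p (s ⊓ t) := by
  refine le_antisymm ?_ (le_inf (single_le_single inf_le_left) (single_le_single inf_le_right))
  rw [eq_single_of_le (inf_le_left : single p s ⊓ single p t ≤ single p s)]
  refine single_le_single (le_inf ?_ ?_)
  · simpa only [single_self] using (inf_le_left : single p s ⊓ single p t ≤ single p s).1 p
  · simpa only [single_self] using (inf_le_right : single p s ⊓ single p t ≤ single p t).1 p

/-- The value `v` is excluded because the meet may lower it to `⊥` when `x` is nonzero above `p`. -/
theorem inf_single_top (x : Pruned P) {p : P} (h : x p ≠ Diamond.v) :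
    x ⊓ single p ⊤ = single p (x p) := by
  rw [eq_single_of_le (inf_le_right : x ⊓ single p ⊤ ≤ single p ⊤)]
  rw [inf_apply, single_self, inf_top_eq]
  rwa [single_self, inf_top_eq]

/-! ### Every congruence comes from a lower set -/

variable {c : LatticeCon (Pruned P)}

theorem rel_sup {x y : Pruned P} (h : c.r x y) (z : Pruned P) : c.r (x ⊔ z) (y ⊔ z) :=
  c.sup h (c.iseqv.refl z)

theorem rel_inf {x y : Pruned P} (h : c.r x y) (z : Pruned P) : c.r (x ⊓ z) (y ⊓ z) :=
  c.inf h (c.iseqv.refl z)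

theorem rel_single_of_single {p : P} {s t : Diamond} (hst : s ≠ t)
    (h : c.r (single p s) (single p t)) : c.r (single p ⊥) (single p ⊤) := by
  refine Diamond.bot_rel_top (r := fun s t => c.r (single p s) (single p t))
    ⟨fun _ => c.iseqv.refl _, fun h => c.iseqv.symm h, fun h₁ h₂ => c.iseqv.trans h₁ h₂⟩
    (fun z h => ?_) (fun z h => ?_) hst h
  · simpa only [single_inf_single] using rel_inf h (single p z)
  · simpa only [single_sup_single] using rel_sup h (single p z)

/-- A congruence identifying two elements which differ at `p` collapses the coordinate `p`. -/
theorem rel_single_of_ne {p : P} {x y : Pruned P} (hne : x p ≠ y p) (h : c.r x y) :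
    c.r (single p ⊥) (single p ⊤) := by
  have key : ∀ {x y : Pruned P}, x p ≠ y p → x p ≠ Diamond.v → y p ≠ Diamond.v → c.r x y →
      c.r (single p ⊥) (single p ⊤) := by
    intro x y hne hx hy h
    refine rel_single_of_single hne ?_
    simpa only [inf_single_top x hx, inf_single_top y hy] using rel_inf h (single p ⊤)
  -- Values equal to `v` are first moved away by a join or meet with `single p d`, so that the
  -- projection by `single p ⊤` is exact.
  obtain ⟨d, ⟨h₁, h₂, h₃⟩ | ⟨h₁, h₂, h₃⟩⟩ := Diamond.exists_separating _ _ hne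
  · have hx : (x ⊔ single p d) p = x p ⊔ d := by
      rw [sup_apply, single_self]; rwa [single_self]
    have hy : (y ⊔ single p d) p = y p ⊔ d := by
      rw [sup_apply, single_self]; rwa [single_self]
    exact key (by rwa [hx, hy]) (by rwa [hx]) (by rwa [hy]) (rel_sup h _)
  · have hx : (x ⊓ single p d) p = x p ⊓ d := by
      rw [inf_apply, single_self]; rwa [single_self]
    have hy : (y ⊓ single p d) p = y p ⊓ d := by
      rw [inf_apply, single_self]; rwa [single_self]
    exact key (by rwa [hx, hy]) (by rwa [hx]) (by rwa [hy]) (rel_inf h _)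

/-- For `q < p`, joining the collapsed pair at `p` with `single q v` changes coordinate `p` of the
latter, so the pruned order forbids the value `v` at `q` in the join. The congruence thus relates
elements that differ at `q`. -/
theorem rel_single_of_le {p q : P} (hqp : q ≤ p) (h : c.r (single p ⊥) (single p ⊤)) :
    c.r (single q ⊥) (single q ⊤) := by
  rcases hqp.eq_or_lt with rfl | hlt
  · exact h
  set d : Pruned P := single q Diamond.v with hd
  have h' : c.r d (single p ⊤ ⊔ d) := by
    have := rel_sup h d
    rwa [single_bot, bot_sup_eq] at this
  refine rel_single_of_ne (p := q) (fun heq => ?_) h'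
  have hdq : d q = Diamond.v := single_self _ _
  have hp := (le_sup_right : d ≤ single p ⊤ ⊔ d).2 q hdq (heq ▸ hdq) p hlt
  have hp' := (le_sup_left : single p ⊤ ≤ single p ⊤ ⊔ d).1 p
  rw [← hp, single_self, hd, single_of_ne hlt.ne'] at hp'
  exact absurd hp' (by decide)

/-- The lower set of coordinates collapsed by a congruence. -/
def collapsed (c : LatticeCon (Pruned P)) : LowerSet P where
  carrier := {p | c.r (single p ⊥) (single p ⊤)}
  lower' _ _ hqp h := rel_single_of_le hqp h

theorem topOn_empty : topOn (∅ : Set P) = (⊥ : Pruned P) := by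
  funext q
  simp [topOn, bot_apply]

theorem single_sup_topOn (p : P) (s : Set P) :
    single p ⊤ ⊔ topOn s = topOn (insert p s) := by
  have hne : ∀ q, single p ⊤ q ⊔ topOn s q ≠ Diamond.v := by
    intro q
    unfold single topOn
    split_ifs <;> decide
  funext q
  rw [sup_apply (hne q)]
  by_cases hq : q = p <;> by_cases hqs : q ∈ s <;> simp [single, topOn, hq, hqs]

theorem rel_topOn_collapsed (c : LatticeCon (Pruned P)) : c.r ⊥ (topOn (collapsed c : Set P)) := by
  suffices h : ∀ s ⊆ (collapsed c : Set P), c.r ⊥ (topOn s) from h _ subset_rfl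
  intro s hs
  induction s, s.toFinite using Set.Finite.induction_on with
  | empty => exact topOn_empty (P := P) ▸ c.iseqv.refl _
  | @insert p s _ _ ih =>
    have h₁ : c.r (single p ⊥) (single p ⊤) := hs (Set.mem_insert p s)
    have h := c.sup h₁ (ih ((Set.subset_insert p s).trans hs))
    rwa [single_bot, bot_sup_eq, single_sup_topOn] at h

theorem agreeOff_collapsed (c : LatticeCon (Pruned P)) : agreeOff (collapsed c) = c := by
  refine le_antisymm (fun x y h => ?_) (fun x y h p hp => ?_)
  · let e : Pruned P := topOn (collapsed c : Set P)
    have hsup (z : Pruned P) : c.r z (z ⊔ e) := by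
      have h' := c.sup (c.iseqv.refl z) (rel_topOn_collapsed c)
      rwa [sup_bot_eq] at h'
    -- Joining with `e` erases the collapsed coordinates, while values off this lower set depend
    -- only on coordinates where `x` and `y` agree.
    have heq : x ⊔ e = y ⊔ e := by
      funext q
      by_cases hq : q ∈ collapsed c
      · have hqe : e q = ⊤ := topOn_of_mem hq
        rw [sup_apply, sup_apply, hqe, sup_top_eq, sup_top_eq]
        all_goals rw [hqe, sup_top_eq]; exact Diamond.isCoatom_v.1.symm
      · exact sup_congr (fun p hp => h p fun hp' => hq ((collapsed c).lower hp hp'))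
          fun _ _ => rfl
    exact c.iseqv.trans (hsup x) (heq ▸ c.iseqv.symm (hsup y))
  · by_contra hne
    exact hp (rel_single_of_ne hne h)

theorem collapsed_agreeOff (I : LowerSet P) : collapsed (agreeOff I) = I := by
  ext p
  refine ⟨fun h => ?_, fun h q hq => ?_⟩
  · by_contra hp
    have := h p hp
    rw [single_self, single_self] at this
    exact absurd this (by decide)
  · have hne : q ≠ p := fun hqp => hq (hqp ▸ h)
    rw [single_of_ne hne, single_of_ne hne]

/-- The congruence lattice of `Pruned P` is the lattice of lower sets of `P`. -/
def conIso : LatticeCon (Pruned P) ≃o LowerSet P where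
  toFun := collapsed
  invFun := agreeOff
  left_inv := agreeOff_collapsed
  right_inv := collapsed_agreeOff
  map_rel_iff' {c d} := by
    refine ⟨fun h => ?_, fun h p hp => h hp⟩
    rw [← agreeOff_collapsed c, ← agreeOff_collapsed d]
    exact fun x y hxy p hp => hxy p fun hp' => hp (h hp')

end Pruned

/-! ### Representation of finite distributive lattices -/

theorem theoremT (D : Type u) [DistribLattice D] [Finite D] [Nonempty D] :
    ∃ (L : Type u) (_ : Lattice L), Finite L ∧ Nonempty L ∧ IsIsoformLattice L ∧
      Nonempty (LatticeCon L ≃o D) := by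
  classical
  have := Fintype.ofFinite D
  let _ : OrderBot D := Fintype.toOrderBot D
  refine ⟨Pruned {a : D // SupIrred a}, inferInstance, inferInstance, ⟨fun _ => ⊥⟩, fun c => ?_,
    ⟨Pruned.conIso.trans OrderIso.lowerSetSupIrred.symm⟩⟩
  rw [← Pruned.agreeOff_collapsed c]
  exact Pruned.isIsoform_agreeOff _
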